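/- All graphs are finite and simple. Let $G=(A\cup B,E)$ be a bipartite graph with colour classes $A$ and $B$ that is a brace, i.e. $G$ is connected, every edge of $G$ lies in a perfect matching, and every tight cut of $G$ is trivial. Let $n=|A|$ and assume $n\ge 2$ (that is, $G\not\cong K_2$). Then $$\mathrm{pmw}(G)=2\quad\Longleftrightarrow\quad G\text{ is isomorphic to a (necessarily spanning) subgraph of the bipartite ladder }L_n .$$ Here $\partial(X)$ denotes the set of edges with exactly one endpoint in $X\subseteq V(G)$. The cut $\partial(Z)$ is *tight* if $|M\cap\partial(Z)|=1$ for every perfect matching $M$ of $G$, and *trivial* if $|Z|=1$ or $|V(G)\setminus Z|=1$. A *perfect matching decomposition* of $G$ is a pair $(T,\delta)$ of a cubic tree $T$ (every vertex has degree $1$ or $3$) and a bijection $\delta$ from the leaves of $T$ to $V(G)$; its *width* is the maximum, over the edges $e$ of $T$ and the perfect matchings $M$ of $G$, of $|M\cap\partial(X_e)|$, where $X_e$ is the image under $\delta$ of the set of leaves in one of the two components of $T-e$. The *perfect matching width* $\mathrm{pmw}(G)$ is the minimum width of a perfect matching decomposition of $G$. The *bipartite ladder* $L_n$ has vertices $a_1,\dots,a_n,b_1,\dots,b_n$,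 and its edges are exactly the $a_ib_j$ with $1\le i,j\le n$ and $j\le i+2$. -/

import Mathlib

/-! Perfect matching width, braces and bipartite ladders. All graphs are finite and simple. -/

namespace PMWidth

/-- The cut `∂(X)`: the edges of `G` joining a vertex of `X` to a vertex outside `X`. -/
def cut {V : Type*} (G : SimpleGraph V) (X : Set V) : Set (Sym2 V) :=
  {e | ∃ x ∈ X, ∃ y ∉ X, G.Adj x y ∧ e = s(x, y)}

/-- The matching porosity of `∂(X)`: the maximum of `|M ∩ ∂(X)|` over the perfect matchings `M`
of `G` (for a finite graph this is a supremum of a bounded set of natural numbers). -/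
noncomputable def porosity {V : Type*} (G : SimpleGraph V) (X : Set V) : ℕ :=
  sSup {k | ∃ M : G.Subgraph, M.IsPerfectMatching ∧ k = (M.edgeSet ∩ cut G X).ncard}

/-- A graph is matching covered if it is connected and each edge lies in a perfect matching. -/
def MatchingCovered {V : Type*} (G : SimpleGraph V) : Prop :=
  G.Connected ∧ ∀ e ∈ G.edgeSet, ∃ M : G.Subgraph, M.IsPerfectMatching ∧ e ∈ M.edgeSet

/-- `∂(Z)` is a tight cut if every perfect matching has exactly one edge in it. -/
def IsTightCut {V : Type*} (G : SimpleGraph V) (Z : Set V) : Prop :=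
  ∀ M : G.Subgraph, M.IsPerfectMatching → (M.edgeSet ∩ cut G Z).ncard = 1

/-- A brace is a bipartite matching covered graph all of whose tight cuts are trivial,
that is, have a shore consisting of a single vertex. -/
def IsBrace {V : Type*} (G : SimpleGraph V) : Prop :=
  G.IsBipartite ∧ MatchingCovered G ∧
    ∀ Z : Set V, IsTightCut G Z → Z.ncard = 1 ∨ Zᶜ.ncard = 1

/-- The leaves of a graph: its vertices of degree one. -/
def leaves {W : Type*} (T : SimpleGraph W) : Set W :=
  {w | (T.neighborSet w).ncard = 1}

/-- A cubic tree: a tree in which every vertex that is not a leaf has degree three. -/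
def IsCubicTree {W : Type*} (T : SimpleGraph W) : Prop :=
  T.IsTree ∧ ∀ w, w ∉ leaves T → (T.neighborSet w).ncard = 3

/-- The vertex set of the component of `T - t₁t₂` that contains `t₁`. -/
def side {W : Type*} (T : SimpleGraph W) (t₁ t₂ : W) : Set W :=
  {w | (T.deleteEdges {s(t₁, t₂)}).Reachable t₁ w}

/-- A perfect matching decomposition of a graph with vertex set `V`: a finite cubic tree together
with a bijection from its leaves to `V`. -/
structure PMDecomposition (V : Type*) where
  /-- the vertex set of the tree -/
  W : Type
  /-- the tree is finite -/
  finite : Finite W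
  /-- the tree -/
  T : SimpleGraph W
  cubic : IsCubicTree T
  /-- the bijection from the leaves of the tree to the vertices of the graph -/
  δ : leaves T ≃ V

/-- The vertices of the graph that are mapped to the leaves on the `t₁`-side of the
tree edge `t₁t₂`. -/
def PMDecomposition.shore {V : Type*} (D : PMDecomposition V) (t₁ t₂ : D.W) : Set V :=
  {v | (D.δ.symm v : D.W) ∈ side D.T t₁ t₂}

/-- The width of a decomposition: the maximum matching porosity of the cuts of `G` that are
induced by the edges of the tree. -/
noncomputable def PMDecomposition.width {V : Type*} (D : PMDecomposition V)
    (G : SimpleGraph V) : ℕ :=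
  sSup {k | ∃ t₁ t₂ : D.W, D.T.Adj t₁ t₂ ∧ k = porosity G (D.shore t₁ t₂)}

/-- The perfect matching width of `G`: the minimum width of a perfect matching decomposition. -/
noncomputable def pmw {V : Type*} (G : SimpleGraph V) : ℕ :=
  sInf {k | ∃ D : PMDecomposition V, k = D.width G}

/-- The bipartite ladder `L_n`: the vertices are `a_i = Sum.inl i` and `b_j = Sum.inr j`, and the
edges are the `a_i b_j` with `j ≤ i + 2` (numbering both classes from `0` instead of `1` does not
affect this condition). -/
def ladder (n : ℕ) : SimpleGraph (Fin n ⊕ Fin n) where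
  Adj
    | Sum.inl i, Sum.inr j => (j : ℕ) ≤ (i : ℕ) + 2
    | Sum.inr j, Sum.inl i => (j : ℕ) ≤ (i : ℕ) + 2
    | _, _ => False
  symm := ⟨by rintro (i | i) (j | j) h <;> exact h⟩
  loopless := ⟨by rintro (i | i) h <;> exact h⟩

end PMWidth

/-!
Let `G` be a brace with colour classes `A` and `B` of size `n`.

**Width two implies the ladder.** Let `X` be a shore of an edge of a decomposition of width two.
Counting matching edges by the colour of their end in `X` shows that a shore of odd size is a tight
cut, hence trivial, and that a shore of even size has an excess of `-2`, `0` or `2` vertices in `B`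
over those in `A`. If the excess is zero, then `X` or its complement is a pair
(`IsBrace.balanced_le_one`): two disjoint edges that leave `X` from `A` would lie in a common
perfect matching, which would meet the cut in four edges, so all these edges form a star, and this
contradicts the surplus `|N(S)| ≥ |S| + 2` that holds for the small subsets `S` of a colour class
of a brace (`IsBrace.ncard_add_two_le_nbhd`). If the excess is two, then all matching edges in the
cut have their ends in `X ∩ B`, and as every edge lies in a perfect matching, no edge leaves `X`
from `A` (`IsBrace.mem_of_adj_of_excess`). For `n ≥ 4` it follows that the tree is a caterpillar of
pairs: a shore with excess two is a pair or splits into a smaller shore with excess two and a pair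
`{a, b}` (`exists_peel`). Numbering the vertices in the order in which these pairs occur along the
caterpillar embeds `G` into the ladder. For `n ≤ 3` the ladder is complete bipartite. Of the tree,
this argument uses only the closure properties collected in `IsShoreFamily`.

**The ladder has width two.** The caterpillar whose pairs of leaves are `{b₀, b₁}`, `{a₀, b₂}`, …,
`{aₙ₋₃, bₙ₋₁}`, `{aₙ₋₂, aₙ₋₁}` has width at most two (`width_ladderDecomposition_le`), and widths do
not grow when passing to a spanning subgraph. Width less than two is impossible in a brace with
`n ≥ 2` (`IsBrace.two_le_porosity`), because an inner edge of the tree would yield a nontrivial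
tight cut or a disconnection.
-/

namespace PMWidth

section

/-- A vertex set that is closed under adjacency contains everything reachable from it. -/
lemma mem_of_reachable {V : Type*} {G : SimpleGraph V} {S : Set V} {u v : V} (hu : u ∈ S)
    (h : ∀ x ∈ S, ∀ y, G.Adj x y → y ∈ S) (huv : G.Reachable u v) : v ∈ S := by
  obtain ⟨p⟩ := huv
  induction p with
  | nil => exact hu
  | cons hadj p ih => exact ih (h _ hu _ hadj)

/-! ### Perfect matchings as fixed-point-free involutions -/

/-- A perfect matching of `G`, encoded as the involution that sends every vertex to the other end
of its matching edge. -/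
structure IsPartner {V : Type*} (G : SimpleGraph V) (f : V → V) : Prop where
  adj : ∀ v, G.Adj v (f v)
  invol : ∀ v, f (f v) = v

/-- The vertices of `X` that are matched to a vertex outside `X`; they correspond to the matching
edges in the cut `∂(X)`. -/
def crossing {V : Type*} (f : V → V) (X : Set V) : Set V := {v | v ∈ X ∧ f v ∉ X}

variable {V : Type*} {G : SimpleGraph V} {A B X Y Z : Set V} {f : V → V}

lemma exists_isPartner {M : G.Subgraph} (hM : M.IsPerfectMatching) :
    ∃ f, IsPartner G f ∧ ∀ v w, M.Adj v w ↔ f v = w := by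
  have h : ∀ v, ∃! w, M.Adj v w := fun v => hM.1 (hM.2 v)
  choose f hf hu using h
  have key : ∀ v w, M.Adj v w ↔ f v = w := fun v w =>
    ⟨fun h => (hu v w h).symm, fun h => h ▸ hf v⟩
  exact ⟨f, ⟨fun v => (hf v).adj_sub, fun v => (key _ _).1 (hf v).symm⟩, key⟩

lemma IsPartner.exists_matching (hf : IsPartner G f) :
    ∃ M : G.Subgraph, M.IsPerfectMatching ∧ ∀ v w, M.Adj v w ↔ f v = w := by
  refine ⟨⟨Set.univ, fun v w => f v = w, ?_, fun _ => trivial, ⟨?_⟩⟩, ⟨?_, ?_⟩, fun _ _ => Iff.rfl⟩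
  · rintro v w rfl; exact hf.adj v
  · rintro v w rfl; exact hf.invol v
  · intro v _
    exact ⟨f v, rfl, fun w h => Eq.symm h⟩
  · intro v; trivial

lemma ncard_edgeSet_inter_cut {M : G.Subgraph} (hf : IsPartner G f)
    (hM : ∀ v w, M.Adj v w ↔ f v = w) (X : Set V) :
    (M.edgeSet ∩ cut G X).ncard = (crossing f X).ncard := by
  have : M.edgeSet ∩ cut G X = (fun v => s(v, f v)) '' crossing f X := by
    ext e
    constructor
    · rintro ⟨he, x, hx, y, hy, hxy, rfl⟩
      have : f x = y := (hM x y).1 he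
      subst this
      exact ⟨x, ⟨hx, hy⟩, rfl⟩
    · rintro ⟨x, ⟨hx, hy⟩, rfl⟩
      exact ⟨(hM x (f x)).2 rfl, x, hx, f x, hy, hf.adj x, rfl⟩
  rw [this, Set.InjOn.ncard_image]
  rintro v ⟨hv, hv'⟩ w ⟨hw, hw'⟩ h
  rcases Sym2.eq_iff.1 h with h | h
  · exact h.1
  · exact absurd (h.1 ▸ hv) hw'

lemma porosity_le_iff [Finite V] {k : ℕ} :
    porosity G X ≤ k ↔ ∀ f, IsPartner G f → (crossing f X).ncard ≤ k := by
  constructor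
  · intro h f hf
    obtain ⟨M, hM, hMf⟩ := hf.exists_matching
    rw [← ncard_edgeSet_inter_cut hf hMf]
    have hbdd : BddAbove {k | ∃ M : G.Subgraph, M.IsPerfectMatching ∧
        k = (M.edgeSet ∩ cut G X).ncard} := by
      refine ⟨Nat.card V, ?_⟩
      rintro _ ⟨M', hM', rfl⟩
      obtain ⟨g, hg, hg'⟩ := exists_isPartner hM'
      rw [ncard_edgeSet_inter_cut hg hg']
      exact Set.ncard_le_card _
    exact le_trans (le_csSup hbdd ⟨M, hM, rfl⟩) h
  · intro h
    refine csSup_le' ?_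
    rintro _ ⟨M', hM', rfl⟩
    obtain ⟨g, hg, hg'⟩ := exists_isPartner hM'
    rw [ncard_edgeSet_inter_cut hg hg']
    exact h g hg

lemma isTightCut_of_crossing (h : ∀ f, IsPartner G f → (crossing f X).ncard = 1) :
    IsTightCut G X := by
  intro M hM
  obtain ⟨g, hg, hg'⟩ := exists_isPartner hM
  rw [ncard_edgeSet_inter_cut hg hg']
  exact h g hg

lemma IsBrace.exists_isPartner_apply (hG : IsBrace G) {u v : V} (h : G.Adj u v) :
    ∃ f, IsPartner G f ∧ f u = v := by
  obtain ⟨M, hM, he⟩ := hG.2.1.2 s(u, v) h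
  obtain ⟨f, hf, hf'⟩ := exists_isPartner hM
  exact ⟨f, hf, (hf' u v).1 he⟩

/-! ### Counting matching edges in the cut of a bipartite graph -/

section Bipartite

variable (hAB : G.IsBipartiteWith A B)
include hAB

variable [Finite V]

/-- Counting the vertices of `X` that are matched inside `X` by their colour. -/
lemma ncard_inter_add_crossing (hf : IsPartner G f) (X : Set V) :
    (X ∩ A).ncard + (crossing f X ∩ B).ncard = (X ∩ B).ncard + (crossing f X ∩ A).ncard := by
  have split : ∀ C : Set V, (X ∩ C).ncard =
      (crossing f X ∩ C).ncard + {v | v ∈ X ∧ v ∈ C ∧ f v ∈ X}.ncard := by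
    intro C
    rw [← Set.ncard_union_eq]
    · congr 1
      ext v
      simp only [crossing, Set.mem_inter_iff, Set.mem_union, Set.mem_ofPred_eq]
      tauto
    · rw [Set.disjoint_left]
      rintro v ⟨⟨_, h⟩, _⟩ ⟨_, _, h'⟩
      exact h h'
  have : {v | v ∈ X ∧ v ∈ B ∧ f v ∈ X} = f '' {v | v ∈ X ∧ v ∈ A ∧ f v ∈ X} := by
    ext v
    constructor
    · rintro ⟨h1, h2, h3⟩
      exact ⟨f v, ⟨h3, hAB.symm.mem_of_mem_adj h2 (hf.adj v), by rwa [hf.invol]⟩, hf.invol v⟩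
    · rintro ⟨w, ⟨h1, h2, h3⟩, rfl⟩
      exact ⟨h3, hAB.mem_of_mem_adj h2 (hf.adj w), by rwa [hf.invol]⟩
  have hinj : Function.Injective f := Function.Involutive.injective hf.invol
  have h2 := Set.ncard_image_of_injective {v | v ∈ X ∧ v ∈ A ∧ f v ∈ X} hinj
  rw [← this] at h2
  rw [split A, split B]
  omega

lemma ncard_right_eq_left (hf : IsPartner G f) : B.ncard = A.ncard := by
  have := ncard_inter_add_crossing hAB hf Set.univ
  have h : crossing f Set.univ = ∅ := by ext; simp [crossing]
  simpa [h] using this.symm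

variable (hcover : A ∪ B = Set.univ)
include hcover

lemma ncard_inter_add_inter (X : Set V) : (X ∩ A).ncard + (X ∩ B).ncard = X.ncard := by
  rw [← Set.ncard_union_eq (hAB.disjoint.mono Set.inter_subset_right Set.inter_subset_right),
    ← Set.inter_union_distrib_left, hcover, Set.inter_univ]

/-- A partner function can be prescribed on one colour class by any injection along edges. -/
lemma exists_isPartner_of_injOn (hcard : B.ncard = A.ncard) {g : V → V} (hg : Set.InjOn g A)
    (hadj : ∀ a ∈ A, G.Adj a (g a)) : ∃ f, IsPartner G f ∧ ∀ a ∈ A, f a = g a := by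
  classical
  have hm : g '' A = B := by
    refine Set.eq_of_subset_of_ncard_le ?_ ?_
    · rintro _ ⟨a, ha, rfl⟩
      exact hAB.mem_of_mem_adj ha (hadj a ha)
    · rw [hg.ncard_image, hcard]
  have hinv : ∀ b, ∃ a, b ∈ B → a ∈ A ∧ g a = b := by
    intro b
    by_cases hb : b ∈ B
    · rw [← hm] at hb
      obtain ⟨a, ha, h⟩ := hb
      exact ⟨a, fun _ => ⟨ha, h⟩⟩
    · exact ⟨b, fun h => absurd h hb⟩
  choose i hi using hinv
  have hnA : ∀ b ∈ B, b ∉ A := fun b hb => hAB.disjoint.notMem_of_mem_right hb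
  have hB : ∀ v, v ∉ A → v ∈ B := fun v hv =>
    (hcover.ge (Set.mem_univ v)).resolve_left hv
  refine ⟨fun v => if v ∈ A then g v else i v, ⟨fun v => ?_, fun v => ?_⟩, fun a ha => if_pos ha⟩
  · by_cases hv : v ∈ A
    · simpa [hv] using hadj v hv
    · have := hi v (hB v hv)
      have h2 := hadj _ this.1
      rw [this.2] at h2
      simpa [hv] using h2.symm
  · by_cases hv : v ∈ A
    · have hgB := hAB.mem_of_mem_adj hv (hadj v hv)
      have := hi _ hgB
      simp [hv, hnA _ hgB, hg this.1 hv this.2]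
    · have := hi v (hB v hv)
      simp [hv, this.1, this.2]

end Bipartite

/-! ### Expansion and extendability in braces -/

/-- The set of neighbours of the vertices of `S`. -/
def nbhd {V : Type*} (G : SimpleGraph V) (S : Set V) : Set V := {w | ∃ v ∈ S, G.Adj v w}

section Brace

variable [Finite V] (hAB : G.IsBipartiteWith A B) (hcover : A ∪ B = Set.univ) (hG : IsBrace G)
include hAB hG

/-- If no edge leaves `X` from `A` and `X` has as many vertices of either colour, then no matching
edge leaves `X` from `B` either, so `X` is a union of components. -/
lemma IsBrace.eq_univ_of_balanced (hne : X.Nonempty)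
    (hout : ∀ a ∈ X ∩ A, ∀ b, G.Adj a b → b ∈ X) (hcard : (X ∩ B).ncard = (X ∩ A).ncard)
    (hXAB : X ⊆ A ∪ B) : X = Set.univ := by
  have hclosed : ∀ u ∈ X, ∀ w, G.Adj u w → w ∈ X := by
    intro u hu w huw
    by_contra hw
    obtain ⟨f, hf, hfu⟩ := hG.exists_isPartner_apply huw
    have hA0 : crossing f X ∩ A = ∅ := by
      ext v
      simp only [crossing, Set.mem_inter_iff, Set.mem_ofPred_eq, Set.mem_empty_iff_false, iff_false]
      rintro ⟨⟨h1, h2⟩, h3⟩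
      exact h2 (hout v ⟨h1, h3⟩ _ (hf.adj v))
    have := ncard_inter_add_crossing hAB hf X
    rw [hA0, Set.ncard_empty, hcard] at this
    have h0 : (crossing f X ∩ B).ncard = 0 := by omega
    rw [Set.ncard_eq_zero] at h0
    have huB : u ∈ B := by
      rcases hXAB hu with h | h
      · exact absurd (hout u ⟨hu, h⟩ w huw) hw
      · exact h
    have : u ∈ crossing f X ∩ B := ⟨⟨hu, by rwa [hfu]⟩, huB⟩
    rw [h0] at this
    exact this
  obtain ⟨x, hx⟩ := hne
  exact Set.eq_univ_of_forall fun y => mem_of_reachable hx hclosed (hG.2.1.1.preconnected x y)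

/-- A set of vertices in one colour class of a brace has surplus at least two, unless it is empty or
misses at most one vertex: otherwise the set and its neighbours span a component or a
nontrivial tight cut. -/
lemma IsBrace.ncard_add_two_le_nbhd {S : Set V} (hS : S ⊆ A) (hne : S.Nonempty)
    (hle : S.ncard + 2 ≤ A.ncard) : S.ncard + 2 ≤ (nbhd G S).ncard := by
  by_contra hlt
  set N := nbhd G S with hN
  have hNB : N ⊆ B := by
    rintro w ⟨v, hv, h⟩
    exact hAB.mem_of_mem_adj (hS hv) h
  have hdis := hAB.disjoint
  have hZA : (S ∪ N) ∩ A = S := by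
    ext v
    constructor
    · rintro ⟨h | h, hA⟩
      · exact h
      · exact absurd (hNB h) (hdis.notMem_of_mem_left hA)
    · exact fun h => ⟨Or.inl h, hS h⟩
  have hZB : (S ∪ N) ∩ B = N := by
    ext v
    constructor
    · rintro ⟨h | h, hB⟩
      · exact absurd hB (hdis.notMem_of_mem_left (hS h))
      · exact h
    · exact fun h => ⟨Or.inr h, hNB h⟩
  have hout : ∀ a ∈ (S ∪ N) ∩ A, ∀ b, G.Adj a b → b ∈ S ∪ N := by
    intro a ha b hab
    rw [hZA] at ha
    exact Or.inr ⟨a, ha, hab⟩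
  have hAd : 2 ≤ (A \ S).ncard := by
    have := Set.ncard_sdiff_add_ncard_of_subset hS
    omega
  have hsub : A \ S ⊆ (S ∪ N)ᶜ := by
    rintro v ⟨h1, h2⟩ (h | h)
    · exact h2 h
    · exact hdis.notMem_of_mem_left h1 (hNB h)
  have hZc := Set.ncard_le_ncard hsub
  have hSpos : 0 < S.ncard := (Set.ncard_pos).2 hne
  have hcross : ∀ f, IsPartner G f → crossing f (S ∪ N) ∩ A = ∅ := by
    intro f hf
    ext v
    simp only [crossing, Set.mem_inter_iff, Set.mem_ofPred_eq, Set.mem_empty_iff_false, iff_false]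
    rintro ⟨⟨h1, h2⟩, h3⟩
    exact h2 (hout v ⟨h1, h3⟩ _ (hf.adj v))
  have hcount : ∀ f, IsPartner G f →
      S.ncard + (crossing f (S ∪ N)).ncard = N.ncard := by
    intro f hf
    have h := ncard_inter_add_crossing hAB hf (S ∪ N)
    rw [hZA, hZB, hcross f hf, Set.ncard_empty, add_zero] at h
    rw [← h]
    congr 2
    ext v
    constructor
    · intro hv
      refine ⟨hv, ?_⟩
      rcases hv.1 with h | h
      · exact absurd (show v ∈ crossing f (S ∪ N) ∩ A from ⟨hv, hS h⟩) (by simp [hcross f hf])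
      · exact hNB h
    · exact fun h => h.1
  obtain ⟨s, hs⟩ := hne
  have hZ2 : 2 ≤ (S ∪ N).ncard := by
    obtain ⟨w, hw⟩ : ∃ w, G.Adj s w := by
      have : Nontrivial V := by
        obtain ⟨t, ht⟩ := (Set.ncard_pos (s := A \ S)).1 (by omega)
        exact ⟨s, t, fun h => ht.2 (h ▸ hs)⟩
      exact hG.2.1.1.preconnected.exists_adj_of_nontrivial s
    have : ({s, w} : Set V) ⊆ S ∪ N := by
      rintro x (rfl | rfl)
      · exact Or.inl hs
      · exact Or.inr ⟨s, hs, hw⟩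
    have h2 := Set.ncard_le_ncard this
    rwa [Set.ncard_pair hw.ne] at h2
  by_cases hd : N.ncard = S.ncard
  · have huniv := hG.eq_univ_of_balanced hAB (X := S ∪ N) ⟨s, Or.inl hs⟩ hout
      (by rw [hZA, hZB, hd]) (Set.union_subset_union hS hNB)
    rw [huniv, Set.compl_univ, Set.ncard_empty] at hZc
    omega
  · have htight : IsTightCut G (S ∪ N) := isTightCut_of_crossing fun f hf => by
      have := hcount f hf
      omega
    rcases hG.2.2 _ htight with h | h <;> omega

include hcover

/-- Two disjoint edges of a brace lie in a common perfect matching, by Hall's theorem. -/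
lemma IsBrace.exists_isPartner_two (hcard : B.ncard = A.ncard) {a₁ a₂ b₁ b₂ : V} (ha₁ : a₁ ∈ A)
    (ha₂ : a₂ ∈ A) (h₁ : G.Adj a₁ b₁) (h₂ : G.Adj a₂ b₂) (ha : a₁ ≠ a₂) (hb : b₁ ≠ b₂) :
    ∃ f, IsPartner G f ∧ f a₁ = b₁ ∧ f a₂ = b₂ := by
  classical
  have := Fintype.ofFinite V
  let ι := {a : V // a ∈ A \ {a₁, a₂}}
  let t : ι → Finset V := fun a => {w | G.Adj a w ∧ w ≠ b₁ ∧ w ≠ b₂}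
  have hall : ∀ s : Finset ι, s.card ≤ (s.biUnion t).card := by
    intro s
    rcases s.eq_empty_or_nonempty with rfl | hs
    · simp
    let S : Set V := (Subtype.val '' (s : Set ι))
    have hSc : S.ncard = s.card := by
      rw [Set.ncard_image_of_injective _ Subtype.val_injective, Set.ncard_coe_finset]
    have hSd : S ⊆ A \ {a₁, a₂} := by
      rintro _ ⟨a, _, rfl⟩
      exact a.2
    have hle : S.ncard + 2 ≤ A.ncard := by
      have h1 := Set.ncard_le_ncard hSd
      have h2 := Set.ncard_sdiff_add_ncard_of_subset (s := {a₁, a₂}) (t := A)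
        (by rintro x (rfl | rfl) <;> assumption)
      rw [Set.ncard_pair ha] at h2
      omega
    have hN := hG.ncard_add_two_le_nbhd hAB (fun x hx => (hSd hx).1)
      (by obtain ⟨x, hx⟩ := hs; exact ⟨x, x, hx, rfl⟩) hle
    have hsub : nbhd G S ⊆ ((s.biUnion t : Finset V) : Set V) ∪ {b₁, b₂} := by
      rintro w ⟨_, ⟨a, has, rfl⟩, haw⟩
      by_cases hw : w = b₁ ∨ w = b₂
      · exact Or.inr hw
      · push Not at hw
        refine Or.inl ?_
        simp only [Finset.coe_biUnion, Set.mem_iUnion]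
        exact ⟨a, has, by simp [t, haw, hw]⟩
    have h3 := (Set.ncard_le_ncard hsub).trans (Set.ncard_union_le _ _)
    rw [Set.ncard_pair hb, Set.ncard_coe_finset] at h3
    omega
  obtain ⟨g, hg, hgt⟩ := (Finset.all_card_le_biUnion_card_iff_exists_injective t).1 hall
  have hgt' : ∀ a : ι, G.Adj a (g a) ∧ g a ≠ b₁ ∧ g a ≠ b₂ := fun a => by
    simpa [t] using hgt a
  let g' : V → V := fun a =>
    if h : a ∈ A \ {a₁, a₂} then g ⟨a, h⟩ else if a = a₁ then b₁ else b₂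
  have e1 : g' a₁ = b₁ := by simp [g']
  have e2 : g' a₂ = b₂ := by simp [g', ha.symm]
  have e3 : ∀ a (h : a ∈ A \ {a₁, a₂}), g' a = g ⟨a, h⟩ := fun a h => dif_pos h
  have cases' : ∀ a ∈ A, a = a₁ ∨ a = a₂ ∨ a ∈ A \ {a₁, a₂} := by
    intro a haA
    by_cases h1 : a = a₁
    · exact Or.inl h1
    by_cases h2 : a = a₂
    · exact Or.inr (Or.inl h2)
    · exact Or.inr (Or.inr ⟨haA, by simp [h1, h2]⟩)
  obtain ⟨f, hf, hfg⟩ := exists_isPartner_of_injOn hAB hcover hcard (g := g') (by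
    intro x hx y hy hxy
    rcases cases' x hx with rfl | rfl | hx' <;> rcases cases' y hy with rfl | rfl | hy'
    · rfl
    · rw [e1, e2] at hxy; exact absurd hxy hb
    · rw [e1, e3 y hy'] at hxy; exact absurd hxy.symm (hgt' _).2.1
    · rw [e1, e2] at hxy; exact absurd hxy.symm hb
    · rfl
    · rw [e2, e3 y hy'] at hxy; exact absurd hxy.symm (hgt' _).2.2
    · rw [e1, e3 x hx'] at hxy; exact absurd hxy (hgt' _).2.1
    · rw [e2, e3 x hx'] at hxy; exact absurd hxy (hgt' _).2.2
    · rw [e3 x hx', e3 y hy'] at hxy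
      exact congrArg Subtype.val (hg hxy)) (by
    intro x hx
    rcases cases' x hx with rfl | rfl | hx'
    · rwa [e1]
    · rwa [e2]
    · rw [e3 x hx']; exact (hgt' ⟨x, hx'⟩).1)
  exact ⟨f, hf, by rw [hfg _ ha₁, e1], by rw [hfg _ ha₂, e2]⟩

/-! ### Shores of porosity two in a brace -/

lemma IsBrace.eq_one_of_odd (hX : porosity G X ≤ 2) (hodd : Odd X.ncard) :
    X.ncard = 1 ∨ Xᶜ.ncard = 1 := by
  refine hG.2.2 X (isTightCut_of_crossing fun f hf => ?_)
  have h1 := porosity_le_iff.1 hX f hf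
  have h2 := ncard_inter_add_crossing hAB hf X
  have h3 := ncard_inter_add_inter hAB hcover (crossing f X)
  have h4 := ncard_inter_add_inter hAB hcover X
  obtain ⟨m, hm⟩ := hodd
  omega

omit hG in
lemma ncard_inter_le_add_two (hX : porosity G X ≤ 2) (hf : IsPartner G f) :
    (X ∩ A).ncard ≤ (X ∩ B).ncard + 2 := by
  have h1 := porosity_le_iff.1 hX f hf
  have h2 := ncard_inter_add_crossing hAB hf X
  have h3 := ncard_inter_add_inter hAB hcover (crossing f X)
  omega

/-- If `X` has two more vertices in `B` than in `A`, then the two matching edges that are allowed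
in `∂(X)` are used up by `B`, so no edge leaves `X` from `A`. -/
lemma IsBrace.mem_of_adj_of_excess (hX : porosity G X ≤ 2)
    (hexc : (X ∩ B).ncard = (X ∩ A).ncard + 2) {a b : V} (ha : a ∈ X ∩ A) (hab : G.Adj a b) :
    b ∈ X := by
  by_contra hb
  obtain ⟨f, hf, hfa⟩ := hG.exists_isPartner_apply hab
  have h1 := porosity_le_iff.1 hX f hf
  have h2 := ncard_inter_add_crossing hAB hf X
  have h3 := ncard_inter_add_inter hAB hcover (crossing f X)
  have h4 : (crossing f X ∩ A).ncard = 0 := by omega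
  rw [Set.ncard_eq_zero] at h4
  have : a ∈ crossing f X ∩ A := ⟨⟨ha.1, by rwa [hfa]⟩, ha.2⟩
  rw [h4] at this
  exact this

/-- A balanced set of porosity at most two is a pair or the complement of a pair: the cut edges
leaving it from `A` are pairwise intersecting, hence form a star, against the surplus
property. -/
lemma IsBrace.balanced_le_one (hcard : B.ncard = A.ncard) (hX : porosity G X ≤ 2)
    (hbal : (X ∩ B).ncard = (X ∩ A).ncard) :
    (X ∩ A).ncard ≤ 1 ∨ A.ncard ≤ (X ∩ A).ncard + 1 := by
  by_contra! hk
  obtain ⟨hk1, hk2⟩ := hk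
  -- Any two cut edges with ends in `A` inside and different ends outside share the end in `A`.
  have disj : ∀ a₁ ∈ X ∩ A, ∀ a₂ ∈ X ∩ A, ∀ b₁ ∉ X, ∀ b₂ ∉ X, G.Adj a₁ b₁ → G.Adj a₂ b₂ →
      b₁ ≠ b₂ → a₁ = a₂ := by
    intro a₁ ha₁ a₂ ha₂ b₁ hb₁ b₂ hb₂ h₁ h₂ hb
    by_contra ha
    obtain ⟨f, hf, e1, e2⟩ := hG.exists_isPartner_two hAB hcover hcard ha₁.2 ha₂.2 h₁ h₂ ha hb
    have h1 := porosity_le_iff.1 hX f hf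
    have h2 := ncard_inter_add_crossing hAB hf X
    have h3 := ncard_inter_add_inter hAB hcover (crossing f X)
    have hsub : ({a₁, a₂} : Set V) ⊆ crossing f X ∩ A := by
      rintro x (rfl | rfl)
      · exact ⟨⟨ha₁.1, by rwa [e1]⟩, ha₁.2⟩
      · exact ⟨⟨ha₂.1, by rwa [e2]⟩, ha₂.2⟩
    have h4 := Set.ncard_le_ncard hsub
    rw [Set.ncard_pair ha] at h4
    omega
  -- By the surplus property, enough neighbours of `S` lie outside `X`.
  have outside : ∀ S ⊆ X ∩ A, S.Nonempty → ∀ m, (X ∩ B).ncard + m ≤ S.ncard + 2 →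
      m ≤ (nbhd G S \ X).ncard := by
    intro S hS hne m hm
    have hle := Set.ncard_le_ncard hS
    have h1 := hG.ncard_add_two_le_nbhd hAB (hS.trans Set.inter_subset_right) hne (by omega)
    have h2 := Set.ncard_inter_add_ncard_sdiff_eq_ncard (nbhd G S) X
    have h3 : (nbhd G S ∩ X).ncard ≤ (X ∩ B).ncard := by
      refine Set.ncard_le_ncard ?_
      rintro w ⟨⟨v, hv, hvw⟩, hw⟩
      exact ⟨hw, hAB.mem_of_mem_adj (hS hv).2 hvw⟩
    omega
  have hne : (X ∩ A).Nonempty := (Set.ncard_pos).1 (by omega)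
  have h2 := outside (X ∩ A) subset_rfl hne 2 (by omega)
  obtain ⟨b₁, ⟨⟨a₁, ha₁, hab₁⟩, hb₁⟩, b₂, ⟨⟨a₂, ha₂, hab₂⟩, hb₂⟩, hb⟩ :=
    (Set.one_lt_ncard).1 h2
  -- Two cut edges at `a₁` and a third one that avoids `a₁`: the third is disjoint from one of them.
  obtain rfl := disj a₁ ha₁ a₂ ha₂ b₁ hb₁ b₂ hb₂ hab₁ hab₂ hb
  have hd := Set.ncard_sdiff_singleton_add_one ha₁
  have h1 := outside ((X ∩ A) \ {a₁}) Set.sdiff_subset ((Set.ncard_pos).1 (by omega)) 1 (by omega)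
  obtain ⟨b₃, ⟨a₃, ha₃, hab₃⟩, hb₃⟩ := (Set.ncard_pos).1 (show 0 < _ from h1)
  by_cases h31 : b₃ = b₁
  · exact ha₃.2 (disj a₃ ha₃.1 a₁ ha₁ b₃ hb₃ b₂ hb₂ hab₃ hab₂ (h31 ▸ hb))
  · exact ha₃.2 (disj a₃ ha₃.1 a₁ ha₁ b₃ hb₃ b₁ hb₁ hab₃ hab₁ h31)

end Brace

end

/-! ### Sides of the edges of a tree -/

section Tree

variable {W : Type*} {T : SimpleGraph W} {t₁ t₂ u v w : W}

lemma mem_side_of_adj (hv : v ∈ side T t₁ t₂) (h : T.Adj v w) (hne : s(v, w) ≠ s(t₁, t₂)) :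
    w ∈ side T t₁ t₂ := by
  refine SimpleGraph.Reachable.trans hv (SimpleGraph.Adj.reachable ?_)
  rw [SimpleGraph.deleteEdges_adj]
  exact ⟨h, hne⟩

/-- The side of a tree edge is the least set that contains its end and is closed under adjacency
along the other edges. -/
lemma side_subset {S : Set W} (h₁ : t₁ ∈ S)
    (h : ∀ v ∈ S, ∀ w, T.Adj v w → s(v, w) ≠ s(t₁, t₂) → w ∈ S) : side T t₁ t₂ ⊆ S := by
  intro x hx
  refine mem_of_reachable h₁ (fun v hv w hvw => ?_) hx
  rw [SimpleGraph.deleteEdges_adj] at hvw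
  exact h v hv w hvw.1 hvw.2

lemma side_union_side (hT : T.Connected) : side T t₁ t₂ ∪ side T t₂ t₁ = Set.univ := by
  refine Set.eq_univ_of_forall fun x => ?_
  refine mem_of_reachable (S := side T t₁ t₂ ∪ side T t₂ t₁)
    (Or.inl (SimpleGraph.Reachable.refl t₁)) (fun v hv w hvw => ?_) (hT.preconnected t₁ x)
  by_cases he : s(v, w) = s(t₁, t₂)
  · rcases Sym2.eq_iff.1 he with ⟨-, rfl⟩ | ⟨-, rfl⟩
    · exact Or.inr (SimpleGraph.Reachable.refl w)
    · exact Or.inl (SimpleGraph.Reachable.refl w)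
  · rcases hv with hv | hv
    · exact Or.inl (mem_side_of_adj hv hvw he)
    · exact Or.inr (mem_side_of_adj hv hvw (by rwa [Sym2.eq_swap (a := t₂)]))

/-- In a connected graph, a set that is left by a single edge is the side of that edge. -/
lemma side_eq_of_unique_crossing (hT : T.Connected) {S : Set W} (h₁ : t₁ ∈ S) (h₂ : t₂ ∉ S)
    (h : ∀ x ∈ S, ∀ y ∉ S, T.Adj x y → x = t₁ ∧ y = t₂) : side T t₁ t₂ = S := by
  refine (side_subset h₁ fun v hv w hvw hne => ?_).antisymm fun x hx => ?_
  · by_contra hw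
    obtain ⟨rfl, rfl⟩ := h v hv w hw hvw
    exact hne rfl
  · have sub : side T t₂ t₁ ⊆ Sᶜ := by
      refine side_subset h₂ fun v hv w hvw hne hw => ?_
      obtain ⟨rfl, rfl⟩ := h w hw v hv hvw.symm
      exact hne rfl
    exact ((side_union_side hT).ge (Set.mem_univ x)).resolve_right fun hx' => sub hx' hx

lemma notMem_side (hT : T.IsTree) (h : T.Adj t₁ t₂) : t₂ ∉ side T t₁ t₂ :=
  SimpleGraph.isBridge_iff.1 (SimpleGraph.isAcyclic_iff_forall_adj_isBridge.1 hT.isAcyclic h)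

lemma side_compl (hT : T.IsTree) (h : T.Adj t₁ t₂) : side T t₂ t₁ = (side T t₁ t₂)ᶜ := by
  refine side_eq_of_unique_crossing hT.connected (notMem_side hT h)
    (not_not.2 (SimpleGraph.Reachable.refl t₁)) fun x hx y hy hxy => ?_
  by_contra hne
  refine hx (mem_side_of_adj (not_not.1 hy) hxy.symm fun he => ?_)
  rcases Sym2.eq_iff.1 he with ⟨rfl, rfl⟩ | ⟨rfl, rfl⟩
  · exact hne ⟨rfl, rfl⟩
  · exact notMem_side hT h (not_not.1 hy)

lemma side_subset_side (hT : T.IsTree) (hu : T.Adj u t₁) (hne : u ≠ t₂) :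
    side T u t₁ ⊆ side T t₁ t₂ := by
  suffices side T u t₁ ⊆ side T u t₁ ∩ side T t₁ t₂ from fun x hx => (this hx).2
  refine side_subset ⟨SimpleGraph.Reachable.refl u, ?_⟩ ?_
  · refine mem_side_of_adj (SimpleGraph.Reachable.refl t₁) hu.symm fun he => ?_
    rcases Sym2.eq_iff.1 he with h | h
    · exact hne h.2
    · exact hu.ne h.2
  · rintro v ⟨hv1, hv2⟩ w hvw he
    have hw1 := mem_side_of_adj hv1 hvw he
    refine ⟨hw1, mem_side_of_adj hv2 hvw fun he' => ?_⟩
    rcases Sym2.eq_iff.1 he' with h | h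
    · exact notMem_side hT hu (h.1 ▸ hv1)
    · exact notMem_side hT hu (h.2 ▸ hw1)

lemma disjoint_side (hT : T.IsTree) (hu : T.Adj u t₁) (hv : T.Adj v t₁) (hne : u ≠ v) :
    Disjoint (side T u t₁) (side T v t₁) := by
  rw [← Set.subset_compl_iff_disjoint_left, ← side_compl hT hu]
  exact side_subset_side hT hv hne.symm

lemma side_eq_iUnion (hT : T.IsTree) :
    side T t₁ t₂ = {t₁} ∪ {w | ∃ u, T.Adj u t₁ ∧ u ≠ t₂ ∧ w ∈ side T u t₁} := by
  refine Set.Subset.antisymm (side_subset (Or.inl rfl) ?_) ?_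
  · rintro v (rfl | ⟨u, hu, hne, hv⟩) w hvw he
    · refine Or.inr ⟨w, hvw.symm, ?_, SimpleGraph.Reachable.refl w⟩
      rintro rfl
      exact he rfl
    · by_cases he' : s(v, w) = s(u, t₁)
      · rcases Sym2.eq_iff.1 he' with h | h
        · exact Or.inl h.2
        · exact Or.inr ⟨u, hu, hne, h.2 ▸ SimpleGraph.Reachable.refl w⟩
      · exact Or.inr ⟨u, hu, hne, mem_side_of_adj hv hvw he'⟩
  · rintro v (rfl | ⟨u, hu, hne, hv⟩)
    · exact SimpleGraph.Reachable.refl _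
    · exact side_subset_side hT hu hne hv

end Tree

/-! ### The family of shores of a decomposition -/

/-- The properties of the family of all shores of a decomposition that are used to bound widths
from below: it is closed under complements and a shore with more than one vertex is the disjoint
union of two others. -/
structure IsShoreFamily {V : Type*} (F : Set (Set V)) : Prop where
  exists_mem : F.Nonempty
  nonempty : ∀ X ∈ F, X.Nonempty
  compl_mem : ∀ X ∈ F, Xᶜ ∈ F
  split : ∀ X ∈ F, X.ncard = 1 ∨ ∃ Y ∈ F, ∃ Z ∈ F, Disjoint Y Z ∧ X = Y ∪ Z

namespace PMDecomposition

variable {V : Type*} (D : PMDecomposition V)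

/-- The set of all shores of a decomposition. -/
def shores : Set (Set V) := {X | ∃ t₁ t₂, D.T.Adj t₁ t₂ ∧ X = D.shore t₁ t₂}

lemma width_le_iff {G : SimpleGraph V} {k : ℕ} :
    D.width G ≤ k ↔ ∀ X ∈ D.shores, porosity G X ≤ k := by
  have := D.finite
  constructor
  · rintro h _ ⟨t₁, t₂, hadj, rfl⟩
    have hbdd : BddAbove {k | ∃ t₁ t₂ : D.W, D.T.Adj t₁ t₂ ∧ k = porosity G (D.shore t₁ t₂)} := by
      refine (Set.Finite.subset
        (Set.finite_range fun p : D.W × D.W => porosity G (D.shore p.1 p.2)) ?_).bddAbove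
      rintro _ ⟨t₁, t₂, -, rfl⟩
      exact ⟨(t₁, t₂), rfl⟩
    exact (le_csSup hbdd ⟨t₁, t₂, hadj, rfl⟩).trans h
  · intro h
    refine csSup_le' ?_
    rintro _ ⟨t₁, t₂, hadj, rfl⟩
    exact h _ ⟨t₁, t₂, hadj, rfl⟩

lemma shore_leaf {t₁ t₂ : D.W} (h : D.T.Adj t₁ t₂) (hl : t₁ ∈ leaves D.T) :
    D.shore t₁ t₂ = {D.δ ⟨t₁, hl⟩} := by
  obtain ⟨x, hx⟩ := Set.ncard_eq_one.1 (show (D.T.neighborSet t₁).ncard = 1 from hl)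
  have hN : ∀ y, D.T.Adj t₁ y → y = t₂ := by
    intro y hy
    have h1 : y ∈ ({x} : Set _) := hx ▸ hy
    have h2 : t₂ ∈ ({x} : Set _) := hx ▸ h
    exact h1.trans h2.symm
  ext v
  have : v ∈ D.shore t₁ t₂ ↔ (D.δ.symm v : D.W) = t₁ := by
    rw [shore, Set.mem_ofPred_eq, side_eq_iUnion D.cubic.1]
    refine ⟨?_, fun h => Or.inl h⟩
    rintro (h | ⟨u, hu, hne, -⟩)
    · exact h
    · exact absurd (hN u hu.symm) hne
  rw [this, Set.mem_singleton_iff, ← D.δ.symm_apply_eq, Subtype.ext_iff]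

lemma shore_split {t₁ t₂ : D.W} (h : D.T.Adj t₁ t₂) (hl : t₁ ∉ leaves D.T) :
    ∃ u v, D.T.Adj u t₁ ∧ D.T.Adj v t₁ ∧ u ≠ t₂ ∧ v ≠ t₂ ∧ u ≠ v ∧
      D.shore t₁ t₂ = D.shore u t₁ ∪ D.shore v t₁ := by
  have h3 := D.cubic.2 t₁ hl
  have := D.finite
  have h2 := Set.ncard_sdiff_singleton_add_one (show t₂ ∈ D.T.neighborSet t₁ from h)
  obtain ⟨u, v, huv, hN⟩ := Set.ncard_eq_two.1
    (show (D.T.neighborSet t₁ \ {t₂}).ncard = 2 by omega)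
  have hu : u ∈ D.T.neighborSet t₁ \ {t₂} := by rw [hN]; exact Or.inl rfl
  have hv : v ∈ D.T.neighborSet t₁ \ {t₂} := by rw [hN]; exact Or.inr rfl
  refine ⟨u, v, hu.1.symm, hv.1.symm, hu.2, hv.2, huv, ?_⟩
  ext x
  simp only [shore, Set.mem_ofPred_eq, Set.mem_union]
  constructor
  · intro hx
    rw [side_eq_iUnion D.cubic.1] at hx
    rcases hx with hx | ⟨y, hy, hne, hx⟩
    · exact absurd ((D.δ.symm x).2) (by rw [show ((D.δ.symm x : D.W)) = t₁ from hx]; exact hl)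
    · have hy' : y ∈ D.T.neighborSet t₁ \ {t₂} := ⟨hy.symm, hne⟩
      rw [hN] at hy'
      rcases hy' with rfl | rfl
      · exact Or.inl hx
      · exact Or.inr hx
  · rintro (hx | hx)
    · exact side_subset_side D.cubic.1 hu.1.symm hu.2 hx
    · exact side_subset_side D.cubic.1 hv.1.symm hv.2 hx

lemma shore_nonempty {t₁ t₂ : D.W} (h : D.T.Adj t₁ t₂) : (D.shore t₁ t₂).Nonempty := by
  have := D.finite
  induction hk : (side D.T t₁ t₂).ncard using Nat.strong_induction_on generalizing t₁ t₂ with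
  | _ k ih =>
    by_cases hl : t₁ ∈ leaves D.T
    · rw [D.shore_leaf h hl]; exact Set.singleton_nonempty _
    · obtain ⟨u, v, hu, hv, hut, hvt, huv, hs⟩ := D.shore_split h hl
      rw [hs]
      refine (ih _ ?_ hu rfl).inl
      rw [← hk]
      refine Set.ncard_lt_ncard ⟨side_subset_side D.cubic.1 hu hut, fun hsub => ?_⟩
      exact notMem_side D.cubic.1 hu (hsub (SimpleGraph.Reachable.refl t₁))

lemma isShoreFamily [Nontrivial V] : IsShoreFamily D.shores where
  exists_mem := by
    have : Nontrivial D.W := (Subtype.val_injective.comp D.δ.symm.injective).nontrivial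
    obtain ⟨w⟩ : Nonempty D.W := inferInstance
    obtain ⟨t, ht⟩ := D.cubic.1.connected.preconnected.exists_adj_of_nontrivial w
    exact ⟨_, w, t, ht, rfl⟩
  nonempty := by
    rintro _ ⟨t₁, t₂, h, rfl⟩
    exact D.shore_nonempty h
  compl_mem := by
    rintro _ ⟨t₁, t₂, h, rfl⟩
    refine ⟨t₂, t₁, h.symm, ?_⟩
    rw [shore, shore, side_compl D.cubic.1 h]
    rfl
  split := by
    rintro _ ⟨t₁, t₂, h, rfl⟩
    by_cases hl : t₁ ∈ leaves D.T
    · left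
      rw [D.shore_leaf h hl, Set.ncard_singleton]
    · right
      obtain ⟨u, v, hu, hv, hut, hvt, huv, hs⟩ := D.shore_split h hl
      refine ⟨_, ⟨u, t₁, hu, rfl⟩, _, ⟨v, t₁, hv, rfl⟩, ?_, hs⟩
      exact Set.disjoint_left.2 fun x hx hx' =>
        Set.disjoint_left.1 (disjoint_side D.cubic.1 hu hv huv) hx hx'

end PMDecomposition

section

variable {V : Type*} [Finite V] {G : SimpleGraph V} {A B X Y Z : Set V} {f : V → V}
  {F : Set (Set V)}

lemma ncard_inter_add_ncard_compl_inter (X C : Set V) :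
    (X ∩ C).ncard + (Xᶜ ∩ C).ncard = C.ncard := by
  rw [← Set.ncard_inter_add_ncard_sdiff_eq_ncard C X, Set.inter_comm, Set.inter_comm Xᶜ]
  rfl

lemma ncard_union_inter (h : Disjoint Y Z) (C : Set V) :
    ((Y ∪ Z) ∩ C).ncard = (Y ∩ C).ncard + (Z ∩ C).ncard := by
  rw [Set.union_inter_distrib_right,
    Set.ncard_union_eq (h.mono Set.inter_subset_left Set.inter_subset_left)]

/-! ### Every decomposition of a brace has width at least two -/

lemma IsShoreFamily.exists_inner (hF : IsShoreFamily F) (hV : 4 ≤ Nat.card V) :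
    ∃ X ∈ F, 2 ≤ X.ncard ∧ 2 ≤ Xᶜ.ncard := by
  have aux : ∀ X ∈ F, 2 ≤ X.ncard → ∃ X ∈ F, 2 ≤ X.ncard ∧ 2 ≤ Xᶜ.ncard := by
    intro X hX h2
    have hc := Set.ncard_add_ncard_compl X
    by_cases hXc : 2 ≤ Xᶜ.ncard
    · exact ⟨X, hX, h2, hXc⟩
    rcases hF.split X hX with h1 | ⟨Y, hY, Z, hZ, hd, rfl⟩
    · omega
    have hYZ := Set.ncard_union_eq hd
    have hYp := (Set.ncard_pos).2 (hF.nonempty Y hY)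
    have hZp := (Set.ncard_pos).2 (hF.nonempty Z hZ)
    have hcp := (Set.ncard_pos).2 (hF.nonempty _ (hF.compl_mem _ hX))
    have hYc := Set.ncard_add_ncard_compl Y
    have hZc := Set.ncard_add_ncard_compl Z
    by_cases hY2 : 2 ≤ Y.ncard
    · exact ⟨Y, hY, hY2, by omega⟩
    · exact ⟨Z, hZ, by omega, by omega⟩
  obtain ⟨X, hX⟩ := hF.exists_mem
  have hc := Set.ncard_add_ncard_compl X
  by_cases h2 : 2 ≤ X.ncard
  · exact aux X hX h2
  · exact aux Xᶜ (hF.compl_mem X hX) (by omega)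

/-- In a brace, a shore with at least two vertices on both sides has porosity at least two:
porosity one would give a nontrivial tight cut, porosity zero a disconnected graph. -/
lemma IsBrace.two_le_porosity (hAB : G.IsBipartiteWith A B) (hcover : A ∪ B = Set.univ)
    (hG : IsBrace G) (hX : 2 ≤ X.ncard) (hXc : 2 ≤ Xᶜ.ncard) : 2 ≤ porosity G X := by
  by_contra hlt
  have hle : porosity G X ≤ 1 := by omega
  rcases Nat.even_or_odd X.ncard with he | ho
  · have h0 : ∀ f, IsPartner G f → crossing f X = ∅ := by
      intro f hf
      have h1 := porosity_le_iff.1 hle f hf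
      have h2 := ncard_inter_add_crossing hAB hf X
      have h3 := ncard_inter_add_inter hAB hcover (crossing f X)
      have h4 := ncard_inter_add_inter hAB hcover X
      obtain ⟨m, hm⟩ := he
      exact (Set.ncard_eq_zero).1 (by omega)
    obtain ⟨x, hx⟩ := (Set.ncard_pos (s := X)).1 (by omega)
    obtain ⟨y, hy⟩ := (Set.ncard_pos (s := Xᶜ)).1 (by omega)
    refine hy (mem_of_reachable hx (fun u hu w huw => ?_) (hG.2.1.1.preconnected x y))
    by_contra hw
    obtain ⟨f, hf, rfl⟩ := hG.exists_isPartner_apply huw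
    have : u ∈ crossing f X := ⟨hu, hw⟩
    rw [h0 f hf] at this
    exact this
  · rcases hG.eq_one_of_odd hAB hcover (hle.trans one_le_two) ho with h | h <;> omega

/-! ### Decompositions of width two are caterpillars of pairs -/

section Forward

variable (hAB : G.IsBipartiteWith A B) (hcover : A ∪ B = Set.univ) (hG : IsBrace G)
  (hf : IsPartner G f) (hF : IsShoreFamily F) (hw : ∀ X ∈ F, porosity G X ≤ 2)
include hAB hcover hG hf hF hw

/-- If all shores of even size were balanced, all shores would have sizes at most two or at
least `|V| - 2`, which is impossible for a smallest shore of the second kind. -/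
lemma exists_excess (hA : 4 ≤ A.ncard) : ∃ X ∈ F, (X ∩ B).ncard = (X ∩ A).ncard + 2 := by
  by_contra! hno
  have hcard := ncard_right_eq_left hAB hf
  have htot : ∀ X : Set V, X.ncard + Xᶜ.ncard = 2 * A.ncard := by
    intro X
    have h1 := ncard_inter_add_inter hAB hcover X
    have h2 := ncard_inter_add_inter hAB hcover Xᶜ
    have h3 := ncard_inter_add_ncard_compl_inter X A
    have h4 := ncard_inter_add_ncard_compl_inter X B
    omega
  have hsize : ∀ X ∈ F, X.ncard ≤ 2 ∨ 2 * A.ncard ≤ X.ncard + 2 := by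
    intro X hX
    have ht := htot X
    have h1 := ncard_inter_add_inter hAB hcover X
    rcases Nat.even_or_odd X.ncard with ⟨m, hm⟩ | ho
    · have h5 := ncard_inter_le_add_two hAB hcover (hw X hX) hf
      have h6 := ncard_inter_le_add_two hAB.symm (Set.union_comm B A ▸ hcover) (hw X hX) hf
      have h7 := hno X hX
      have h8 := hno Xᶜ (hF.compl_mem X hX)
      have h3 := ncard_inter_add_ncard_compl_inter X A
      have h4 := ncard_inter_add_ncard_compl_inter X B
      have := hG.balanced_le_one hAB hcover hcard (hw X hX) (by omega)
      omega
    · have := hG.eq_one_of_odd hAB hcover (hw X hX) ho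
      omega
  have descend : ∀ k, ∀ X ∈ F, X.ncard = k → X.ncard ≤ 2 := by
    intro k
    induction k using Nat.strong_induction_on with
    | _ k ih =>
      intro X hX hk
      rcases hsize X hX with h | h
      · exact h
      rcases hF.split X hX with h1 | ⟨Y, hY, Z, hZ, hd, rfl⟩
      · omega
      have hYZ := Set.ncard_union_eq hd
      have hYp := (Set.ncard_pos).2 (hF.nonempty Y hY)
      have hZp := (Set.ncard_pos).2 (hF.nonempty Z hZ)
      have h1 := ih _ (by omega) Y hY rfl
      have h2 := ih _ (by omega) Z hZ rfl
      omega
  obtain ⟨X, hX⟩ := hF.exists_mem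
  have h1 := descend _ X hX rfl
  have h2 := descend _ Xᶜ (hF.compl_mem X hX) rfl
  have := htot X
  omega

/-- A shore with an excess of two in `B` that is not a pair arises from a smaller one by adding
one vertex of each colour: of the two shores into which it splits, one carries the whole excess
and the other one is balanced, hence a pair. -/
lemma exists_peel (hX : X ∈ F) (hexc : (X ∩ B).ncard = (X ∩ A).ncard + 2)
    (hpos : 0 < (X ∩ A).ncard) : ∃ Y ∈ F, ∃ a ∈ A, ∃ b ∈ B, a ∉ Y ∧ b ∉ Y ∧
      X = Y ∪ {a, b} ∧ (Y ∩ B).ncard = (Y ∩ A).ncard + 2 := by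
  have hcard := ncard_right_eq_left hAB hf
  have hcover' : B ∪ A = Set.univ := Set.union_comm B A ▸ hcover
  have h1 := ncard_inter_add_inter hAB hcover X
  have h3 := ncard_inter_add_ncard_compl_inter X A
  have h4 := ncard_inter_add_ncard_compl_inter X B
  have main : ∀ Y ∈ F, ∀ Z ∈ F, Disjoint Y Z → X = Y ∪ Z →
      (Z ∩ B).ncard = (Z ∩ A).ncard → ∃ Y ∈ F, ∃ a ∈ A, ∃ b ∈ B, a ∉ Y ∧ b ∉ Y ∧
      X = Y ∪ {a, b} ∧ (Y ∩ B).ncard = (Y ∩ A).ncard + 2 := by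
    rintro Y hY Z hZ hd rfl hbal
    have hYA := ncard_union_inter hd A
    have hYB := ncard_union_inter hd B
    have hZp := (Set.ncard_pos).2 (hF.nonempty Z hZ)
    have h2 := ncard_inter_add_inter hAB hcover Z
    have h5 := hG.balanced_le_one hAB hcover hcard (hw Z hZ) hbal
    obtain ⟨a, ha⟩ := Set.ncard_eq_one.1 (show (Z ∩ A).ncard = 1 by omega)
    obtain ⟨b, hb⟩ := Set.ncard_eq_one.1 (show (Z ∩ B).ncard = 1 by omega)
    have haZ : a ∈ Z ∩ A := ha ▸ Set.mem_singleton a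
    have hbZ : b ∈ Z ∩ B := hb ▸ Set.mem_singleton b
    refine ⟨Y, hY, a, haZ.2, b, hbZ.2, hd.notMem_of_mem_right haZ.1,
      hd.notMem_of_mem_right hbZ.1, ?_, by omega⟩
    rw [show Z = {a, b} by
      rw [Set.insert_eq, ← ha, ← hb, ← Set.inter_union_distrib_left, hcover, Set.inter_univ]]
  rcases hF.split X hX with h1 | ⟨Y, hY, Z, hZ, hd, hXYZ⟩
  · omega
  have hcardX := Set.ncard_union_eq hd
  rw [← hXYZ] at hcardX
  rcases Nat.even_or_odd Y.ncard with ⟨m, hm⟩ | ho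
  · have hYA := ncard_union_inter hd A
    have hYB := ncard_union_inter hd B
    rw [← hXYZ] at hYA hYB
    have hy := ncard_inter_add_inter hAB hcover Y
    have y1 := ncard_inter_le_add_two hAB hcover (hw Y hY) hf
    have z1 := ncard_inter_le_add_two hAB hcover (hw Z hZ) hf
    have y2 := ncard_inter_le_add_two hAB.symm hcover' (hw Y hY) hf
    have z2 := ncard_inter_le_add_two hAB.symm hcover' (hw Z hZ) hf
    by_cases hbal : (Z ∩ B).ncard = (Z ∩ A).ncard
    · exact main Y hY Z hZ hd hXYZ hbal
    · refine main Z hZ Y hY hd.symm (hXYZ.trans (Set.union_comm _ _)) ?_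
      clear main h3 h4 hcard hcardX h1
      omega
  -- Two odd parts would both be trivial, hence single vertices, so that `X` would be a pair.
  · clear main
    have hoZ : Odd Z.ncard := by
      obtain ⟨m, hm⟩ := ho
      exact ⟨(X ∩ A).ncard - m, by omega⟩
    have hXc : 2 ≤ Xᶜ.ncard := by
      rw [← ncard_inter_add_inter hAB hcover Xᶜ]
      omega
    have hX4 : 4 ≤ X.ncard := by omega
    clear h1 h3 h4
    have hX' := Set.ncard_add_ncard_compl X
    have hY' := Set.ncard_add_ncard_compl Y
    have hZ' := Set.ncard_add_ncard_compl Z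
    have e1 := hG.eq_one_of_odd hAB hcover (hw Y hY) ho
    have e2 := hG.eq_one_of_odd hAB hcover (hw Z hZ) hoZ
    omega

/-- Peeling off the pairs one after the other yields a numbering of a shore with excess two along
which the edges satisfy the condition defining the ladder. -/
lemma exists_rank (hX : X ∈ F) (hexc : (X ∩ B).ncard = (X ∩ A).ncard + 2) :
    ∃ r : V → ℕ, Set.InjOn r (X ∩ A) ∧ Set.InjOn r (X ∩ B) ∧
      (∀ a ∈ X ∩ A, r a < (X ∩ A).ncard) ∧ (∀ b ∈ X ∩ B, r b < (X ∩ A).ncard + 2) ∧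
      ∀ a ∈ X ∩ A, ∀ b ∈ X ∩ B, G.Adj a b → r b ≤ r a + 2 := by
  classical
  induction hk : (X ∩ A).ncard generalizing X with
  | zero =>
    have hA0 : X ∩ A = ∅ := (Set.ncard_eq_zero).1 hk
    obtain ⟨x, y, hxy, hB⟩ := Set.ncard_eq_two.1 (hexc.trans (by rw [hk]))
    refine ⟨fun v => if v = x then 0 else 1, by simp [hA0], ?_, by simp [hA0], ?_, by simp [hA0]⟩
    · rw [hB]
      rintro u (rfl | rfl) v (rfl | rfl) <;> simp [hxy, hxy.symm]
    · intro b _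
      dsimp only
      split_ifs <;> omega
  | succ k ih =>
    obtain ⟨Y, hY, a, ha, b, hb, haY, hbY, rfl, hYexc⟩ :=
      exists_peel hAB hcover hG hf hF hw hX hexc (by omega)
    have hbA : b ∉ A := hAB.disjoint.notMem_of_mem_right hb
    have haB : a ∉ B := hAB.disjoint.notMem_of_mem_left ha
    have hab : a ≠ b := fun h => hbA (h ▸ ha)
    have hXA : (Y ∪ {a, b}) ∩ A = insert a (Y ∩ A) := by
      ext v
      constructor
      · rintro ⟨h | rfl | rfl, hA⟩
        · exact Or.inr ⟨h, hA⟩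
        · exact Or.inl rfl
        · exact absurd hA hbA
      · rintro (rfl | h)
        · exact ⟨Or.inr (Or.inl rfl), ha⟩
        · exact ⟨Or.inl h.1, h.2⟩
    have hXB : (Y ∪ {a, b}) ∩ B = insert b (Y ∩ B) := by
      ext v
      constructor
      · rintro ⟨h | rfl | rfl, hA⟩
        · exact Or.inr ⟨h, hA⟩
        · exact absurd hA haB
        · exact Or.inl rfl
      · rintro (rfl | h)
        · exact ⟨Or.inr (Or.inr rfl), hb⟩
        · exact ⟨Or.inl h.1, h.2⟩
    have haY' : a ∉ Y ∩ A := fun h => haY h.1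
    have hbY' : b ∉ Y ∩ B := fun h => hbY h.1
    have hYk : (Y ∩ A).ncard = k := by
      have := Set.ncard_insert_of_notMem haY'
      rw [← hXA] at this
      omega
    obtain ⟨r, hrA, hrB, hltA, hltB, hadj⟩ := ih hY hYexc hYk
    let r' : V → ℕ := fun v => if v = a then k else if v = b then k + 2 else r v
    have ea : r' a = k := if_pos rfl
    have eb : r' b = k + 2 := by simp [r', hab.symm]
    have eY : ∀ v ∈ Y, r' v = r v := by
      intro v hv
      have h1 : v ≠ a := fun h => haY (h ▸ hv)
      have h2 : v ≠ b := fun h => hbY (h ▸ hv)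
      simp [r', h1, h2]
    rw [hXA, hXB]
    refine ⟨r', ?_, ?_, ?_, ?_, ?_⟩
    · refine (Set.injOn_insert haY').2 ⟨hrA.congr fun v hv => (eY v hv.1).symm, ?_⟩
      rintro ⟨v, hv, h⟩
      have := hltA v hv
      rw [eY v hv.1, ea] at h
      omega
    · refine (Set.injOn_insert hbY').2 ⟨hrB.congr fun v hv => (eY v hv.1).symm, ?_⟩
      rintro ⟨v, hv, h⟩
      have := hltB v hv
      rw [eY v hv.1, eb] at h
      omega
    · rintro v (rfl | hv)
      · omega
      · have := hltA v hv
        rw [eY v hv.1]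
        omega
    · rintro v (rfl | hv)
      · omega
      · have := hltB v hv
        rw [eY v hv.1]
        omega
    · rintro u (rfl | hu) v (rfl | hv) huv
      · omega
      · have := hltB v hv
        rw [eY v hv.1]
        omega
      · exact absurd (hG.mem_of_adj_of_excess hAB hcover (hw Y hY) hYexc hu huv) hbY
      · rw [eY u hu.1, eY v hv.1]
        exact hadj u hu v hv huv

/-- A largest shore with excess two in `B` misses only two vertices of `A`. -/
lemma exists_excess_compl_pair (hA : 4 ≤ A.ncard) : ∃ X ∈ F,
    (X ∩ B).ncard = (X ∩ A).ncard + 2 ∧ (X ∩ A).ncard + 2 = A.ncard := by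
  have hcard := ncard_right_eq_left hAB hf
  obtain ⟨X, ⟨hX, hexc⟩, hmax⟩ := Set.exists_max_image
    {X | X ∈ F ∧ (X ∩ B).ncard = (X ∩ A).ncard + 2} Set.ncard (Set.toFinite _)
    (exists_excess hAB hcover hG hf hF hw hA)
  refine ⟨X, hX, hexc, ?_⟩
  by_contra hne
  have h3 := ncard_inter_add_ncard_compl_inter X A
  have h4 := ncard_inter_add_ncard_compl_inter X B
  obtain ⟨Y, hY, a, -, b, -, ha, -, hXY, hYexc⟩ := exists_peel hAB.symm
    (Set.union_comm B A ▸ hcover) hG hf hF hw (hF.compl_mem X hX) (by omega) (by omega)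
  have h5 := ncard_inter_add_ncard_compl_inter Y A
  have h6 := ncard_inter_add_ncard_compl_inter Y B
  have h7 := hmax Yᶜ ⟨hF.compl_mem Y hY, by omega⟩
  have h8 : Y.ncard < Xᶜ.ncard := by
    refine Set.ncard_lt_ncard ⟨hXY ▸ Set.subset_union_left, fun h => ha (h ?_)⟩
    rw [hXY]
    exact Or.inr (Or.inl rfl)
  have h9 := Set.ncard_add_ncard_compl X
  have h10 := Set.ncard_add_ncard_compl Y
  omega

end Forward

omit [Finite V] in
/-- A numbering of both colour classes that respects the condition on the edges of the ladder
embeds the graph into the ladder. -/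
lemma isContained_ladder (hAB : G.IsBipartiteWith A B) (hcover : A ∪ B = Set.univ) {n : ℕ}
    (r : V → ℕ) (hr : ∀ v, r v < n) (hrA : Set.InjOn r A) (hrB : Set.InjOn r B)
    (hadj : ∀ a ∈ A, ∀ b ∈ B, G.Adj a b → r b ≤ r a + 2) : G.IsContained (ladder n) := by
  classical
  let φ : V → Fin n ⊕ Fin n := fun v => if v ∈ A then Sum.inl ⟨r v, hr v⟩ else Sum.inr ⟨r v, hr v⟩
  have hφA : ∀ v ∈ A, φ v = Sum.inl ⟨r v, hr v⟩ := fun v hv => if_pos hv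
  have hφB : ∀ v ∈ B, φ v = Sum.inr ⟨r v, hr v⟩ :=
    fun v hv => if_neg (hAB.disjoint.notMem_of_mem_right hv)
  have hmem : ∀ v, v ∈ A ∨ v ∈ B := fun v => hcover.ge (Set.mem_univ v)
  refine ⟨⟨⟨φ, fun {u v} huv => ?_⟩, fun u v huv => ?_⟩⟩
  · rcases hAB.mem_of_adj huv with ⟨hu, hv⟩ | ⟨hu, hv⟩
    · rw [hφA u hu, hφB v hv]
      exact hadj u hu v hv huv
    · rw [hφB u hu, hφA v hv]
      exact hadj v hv u hu huv.symm
  · change φ u = φ v at huv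
    rcases hmem u with hu | hu <;> rcases hmem v with hv | hv
    · rw [hφA u hu, hφA v hv] at huv
      exact hrA hu hv (by simpa using huv)
    · rw [hφA u hu, hφB v hv] at huv
      simp at huv
    · rw [hφB u hu, hφA v hv] at huv
      simp at huv
    · rw [hφB u hu, hφB v hv] at huv
      exact hrB hu hv (by simpa using huv)

lemma exists_numbering (C : Set V) : ∃ r : V → ℕ, Set.InjOn r C ∧ ∀ v ∈ C, r v < C.ncard := by
  classical
  let e : C ≃ Fin C.ncard := Finite.equivFin C
  refine ⟨fun v => if h : v ∈ C then e ⟨v, h⟩ else 0, fun u hu v hv h => ?_, fun v hv => ?_⟩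
  · simp only [hu, hv, dif_pos] at h
    simpa using e.injective (Fin.ext h)
  · simp [hv]

lemma isContained_ladder_of_shores (hAB : G.IsBipartiteWith A B) (hcover : A ∪ B = Set.univ)
    (hG : IsBrace G) (hf : IsPartner G f) (hF : IsShoreFamily F)
    (hw : ∀ X ∈ F, porosity G X ≤ 2) : G.IsContained (ladder A.ncard) := by
  classical
  have hcard := ncard_right_eq_left hAB hf
  have hBA : ∀ b ∈ B, b ∉ A := fun b hb => hAB.disjoint.notMem_of_mem_right hb
  have hmem : ∀ v, v ∈ A ∨ v ∈ B := fun v => hcover.ge (Set.mem_univ v)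
  by_cases hA : 4 ≤ A.ncard
  · obtain ⟨X, hX, hexc, hXA⟩ := exists_excess_compl_pair hAB hcover hG hf hF hw hA
    obtain ⟨r, hrA, hrB, hltA, hltB, hadj⟩ := exists_rank hAB hcover hG hf hF hw hX hexc
    have hXB : ∀ b ∈ B, b ∈ X ∩ B := by
      have : X ∩ B = B := Set.eq_of_subset_of_ncard_le Set.inter_subset_right (by omega)
      intro b hb
      rwa [this]
    obtain ⟨s, hs, hslt⟩ := exists_numbering (Xᶜ ∩ A)
    have hc := ncard_inter_add_ncard_compl_inter X A
    -- The two vertices outside `X` come last among those of `A`.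
    let r' : V → ℕ := fun v => if v ∈ X then r v else (X ∩ A).ncard + s v
    have e1 : ∀ v ∈ X, r' v = r v := fun v hv => if_pos hv
    have e2 : ∀ v ∉ X, r' v = (X ∩ A).ncard + s v := fun v hv => if_neg hv
    refine isContained_ladder hAB hcover r' ?_ ?_ ?_ ?_
    · intro v
      rcases hmem v with hv | hv
      · by_cases hvX : v ∈ X
        · have := hltA v ⟨hvX, hv⟩
          rw [e1 v hvX]
          omega
        · have := hslt v ⟨hvX, hv⟩
          rw [e2 v hvX]
          omega
      · have := hltB v (hXB v hv)
        rw [e1 v (hXB v hv).1]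
        omega
    · intro u hu v hv huv
      by_cases huX : u ∈ X <;> by_cases hvX : v ∈ X
      · rw [e1 u huX, e1 v hvX] at huv
        exact hrA ⟨huX, hu⟩ ⟨hvX, hv⟩ huv
      · have := hltA u ⟨huX, hu⟩
        rw [e1 u huX, e2 v hvX] at huv
        omega
      · have := hltA v ⟨hvX, hv⟩
        rw [e2 u huX, e1 v hvX] at huv
        omega
      · rw [e2 u huX, e2 v hvX] at huv
        exact hs ⟨huX, hu⟩ ⟨hvX, hv⟩ (by omega)
    · intro u hu v hv huv
      rw [e1 u (hXB u hu).1, e1 v (hXB v hv).1] at huv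
      exact hrB (hXB u hu) (hXB v hv) huv
    · intro a ha b hb hab
      have hb' := hXB b hb
      by_cases haX : a ∈ X
      · rw [e1 a haX, e1 b hb'.1]
        exact hadj a ⟨haX, ha⟩ b hb' hab
      · have := hltB b hb'
        rw [e2 a haX, e1 b hb'.1]
        omega
  · -- The ladder with at most three rungs is complete bipartite.
    obtain ⟨r, hr, hrlt⟩ := exists_numbering A
    obtain ⟨s, hs, hslt⟩ := exists_numbering B
    let r' : V → ℕ := fun v => if v ∈ A then r v else s v
    have e1 : ∀ v ∈ A, r' v = r v := fun v hv => if_pos hv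
    have e2 : ∀ v ∈ B, r' v = s v := fun v hv => if_neg (hBA v hv)
    refine isContained_ladder hAB hcover r' ?_ (hr.congr fun v hv => (e1 v hv).symm)
      (hs.congr fun v hv => (e2 v hv).symm) ?_
    · intro v
      rcases hmem v with hv | hv
      · rw [e1 v hv]
        exact hrlt v hv
      · rw [e2 v hv]
        have := hslt v hv
        omega
    · intro a ha b hb _
      have := hslt b hb
      rw [e2 b hb]
      omega

end

section

/-! ### The caterpillar of pairs of a ladder -/

/-- The vertices of the caterpillar of pairs for the ladder with `m + 2` rungs. -/
inductive CaterpillarVertex (m : ℕ) : Type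
  /-- the leaf that carries a vertex of the ladder -/
  | leaf (v : Fin (m + 2) ⊕ Fin (m + 2))
  /-- the inner vertex that joins a pair of leaves to an inner vertex of the spine -/
  | pair (k : Fin m)
  /-- a vertex of the spine; two leaves are attached to either end of the spine -/
  | spine (i : Fin (m + 2))

open CaterpillarVertex

/-- The position along the spine of the pair of leaves to which a vertex of the ladder belongs:
the pairs are `{b₀, b₁}, {a₀, b₂}, …, {aₘ₋₁, bₘ₊₁}, {aₘ, aₘ₊₁}`. The truncated subtraction
puts both `b₀` and `b₁` at position `0`, and the minimum puts both `aₘ` and `aₘ₊₁` at `m + 1`. -/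
def pairIndex {m : ℕ} : Fin (m + 2) ⊕ Fin (m + 2) → ℕ
  | Sum.inl i => min ((i : ℕ) + 1) (m + 1)
  | Sum.inr j => (j : ℕ) - 1

variable {m : ℕ}

/-- The edges of the caterpillar, directed towards the last vertex of the spine. -/
def caterpillarRel : CaterpillarVertex m → CaterpillarVertex m → Prop
  | leaf v, pair k => pairIndex v = k + 1
  | leaf v, spine i => pairIndex v = i ∧ ((i : ℕ) = 0 ∨ (i : ℕ) = m + 1)
  | pair k, spine i => (i : ℕ) = k + 1
  | spine i, spine j => (j : ℕ) = i + 1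
  | _, _ => False

/-- `caterpillarBelow x w` says that `x` can be reached from `w` along directed edges of the
caterpillar. -/
def caterpillarBelow : CaterpillarVertex m → CaterpillarVertex m → Prop
  | leaf v, leaf w => w = v
  | pair k, leaf w => pairIndex w = k + 1
  | pair k, pair l => l = k
  | spine i, leaf w => pairIndex w ≤ i
  | spine i, pair l => (l : ℕ) + 1 ≤ i
  | spine i, spine j => (j : ℕ) ≤ i
  | _, _ => False

lemma pairIndex_lt (v : Fin (m + 2) ⊕ Fin (m + 2)) : pairIndex v < m + 2 := by
  rcases v with i | j <;> simp only [pairIndex] <;> omega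

/-- The caterpillar of pairs. -/
def caterpillar (m : ℕ) : SimpleGraph (CaterpillarVertex m) where
  Adj x y := caterpillarRel x y ∨ caterpillarRel y x
  symm := ⟨fun _ _ h => h.symm⟩
  loopless := ⟨by rintro (v | k | i) h <;> simp [caterpillarRel] at h⟩

instance : Finite (CaterpillarVertex m) := by
  refine Finite.of_surjective
    (fun x : (Fin (m + 2) ⊕ Fin (m + 2)) ⊕ Fin m ⊕ Fin (m + 2) =>
      Sum.elim leaf (Sum.elim pair spine) x) ?_
  rintro (v | k | i)
  exacts [⟨Sum.inl v, rfl⟩, ⟨Sum.inr (Sum.inl k), rfl⟩, ⟨Sum.inr (Sum.inr i), rfl⟩]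

lemma exists_caterpillarRel_leaf (v : Fin (m + 2) ⊕ Fin (m + 2)) :
    ∃ y, ∀ w, (caterpillar m).Adj (leaf v) w ↔ w = y := by
  have hv := pairIndex_lt v
  by_cases h : pairIndex v = 0 ∨ pairIndex v = m + 1
  · refine ⟨spine ⟨pairIndex v, hv⟩, ?_⟩
    rintro (w | l | i) <;> simp [caterpillar, caterpillarRel, Fin.ext_iff, -Fin.val_eq_zero_iff] <;> omega
  · refine ⟨pair ⟨pairIndex v - 1, by omega⟩, ?_⟩
    rintro (w | l | i) <;> simp [caterpillar, caterpillarRel, Fin.ext_iff, -Fin.val_eq_zero_iff] <;> omega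

lemma ncard_neighborSet_leaf (v : Fin (m + 2) ⊕ Fin (m + 2)) :
    ((caterpillar m).neighborSet (leaf v)).ncard = 1 := by
  obtain ⟨y, hy⟩ := exists_caterpillarRel_leaf v
  exact Set.ncard_eq_one.2 ⟨y, Set.ext hy⟩

lemma ncard_neighborSet_pair (k : Fin m) :
    ((caterpillar m).neighborSet (pair k)).ncard = 3 := by
  rw [Set.ncard_eq_three]
  refine ⟨leaf (Sum.inl ⟨k, by omega⟩), leaf (Sum.inr ⟨k + 2, by omega⟩), spine ⟨k + 1, by omega⟩,
    by simp, by simp, by simp, ?_⟩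
  ext w
  rcases w with ((i | j) | l | i) <;>
    simp [caterpillar, caterpillarRel, pairIndex, Fin.ext_iff, -Fin.val_eq_zero_iff] <;> omega

lemma ncard_neighborSet_spine (i : Fin (m + 2)) :
    ((caterpillar m).neighborSet (spine i)).ncard = 3 := by
  rw [Set.ncard_eq_three]
  by_cases h0 : (i : ℕ) = 0
  · refine ⟨leaf (Sum.inr ⟨0, by omega⟩), leaf (Sum.inr ⟨1, by omega⟩), spine ⟨1, by omega⟩,
      by simp, by simp, by simp, ?_⟩
    ext w
    rcases w with ((i | j) | l | i) <;>
      simp [caterpillar, caterpillarRel, pairIndex, Fin.ext_iff, -Fin.val_eq_zero_iff] <;> omega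
  by_cases h1 : (i : ℕ) = m + 1
  · refine ⟨leaf (Sum.inl ⟨m, by omega⟩), leaf (Sum.inl ⟨m + 1, by omega⟩), spine ⟨m, by omega⟩,
      by simp, by simp, by simp, ?_⟩
    ext w
    rcases w with ((i | j) | l | i) <;>
      simp [caterpillar, caterpillarRel, pairIndex, Fin.ext_iff, -Fin.val_eq_zero_iff] <;> omega
  · refine ⟨pair ⟨i - 1, by omega⟩, spine ⟨i - 1, by omega⟩, spine ⟨i + 1, by omega⟩,
      by simp, by simp, by simp, ?_⟩
    ext w
    rcases w with ((i | j) | l | i) <;>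
      simp [caterpillar, caterpillarRel, pairIndex, Fin.ext_iff, -Fin.val_eq_zero_iff] <;> omega

lemma mem_leaves_caterpillar (w : CaterpillarVertex m) :
    w ∈ leaves (caterpillar m) ↔ ∃ v, w = leaf v := by
  rcases w with v | k | i
  · exact ⟨fun _ => ⟨v, rfl⟩, fun _ => ncard_neighborSet_leaf v⟩
  · have h : pair k ∉ leaves (caterpillar m) := fun h => by
      have h1 : ((caterpillar m).neighborSet (pair k)).ncard = 1 := h
      rw [ncard_neighborSet_pair] at h1
      omega
    simp [h]
  · have h : spine i ∉ leaves (caterpillar m) := fun h => by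
      have h1 : ((caterpillar m).neighborSet (spine i)).ncard = 1 := h
      rw [ncard_neighborSet_spine] at h1
      omega
    simp [h]

lemma caterpillar_connected : (caterpillar m).Connected := by
  rw [SimpleGraph.connected_iff_exists_forall_reachable]
  refine ⟨spine 0, ?_⟩
  have hs : ∀ k (hk : k < m + 2), (caterpillar m).Reachable (spine 0) (spine ⟨k, hk⟩) := by
    intro k
    induction k with
    | zero => intro _; exact SimpleGraph.Reachable.refl _
    | succ k ih =>
      intro hk
      exact (ih (by omega)).trans (SimpleGraph.Adj.reachable (Or.inl rfl))
  have hp : ∀ k, (caterpillar m).Reachable (spine 0) (pair k) := fun k =>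
    (hs (k + 1) (by omega)).trans (SimpleGraph.Adj.reachable (Or.inr rfl))
  rintro (v | k | i)
  · obtain ⟨y, hy⟩ := exists_caterpillarRel_leaf v
    have hadj := (hy y).2 rfl
    rcases y with w | k | i
    · simp [caterpillar, caterpillarRel] at hadj
    · exact (hp k).trans (SimpleGraph.Adj.reachable hadj.symm)
    · exact (hs i i.2).trans (SimpleGraph.Adj.reachable hadj.symm)
  · exact hp k
  · exact hs i i.2

lemma caterpillarBelow_unique {x y u w : CaterpillarVertex m} (h : caterpillarRel x y)
    (hu : caterpillarBelow x u) (hw : ¬ caterpillarBelow x w) (huw : (caterpillar m).Adj u w) :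
    u = x ∧ w = y := by
  rcases x with v | k | i
  · rcases u with u | l | j <;> simp only [caterpillarBelow] at hu
    subst hu
    obtain ⟨z, hz⟩ := exists_caterpillarRel_leaf u
    exact ⟨rfl, ((hz w).1 huw).trans ((hz y).1 (Or.inl h)).symm⟩
  · rcases y with y | l | j <;> simp only [caterpillarRel] at h
    rcases u with u | l | i <;> rcases w with w | l' | i' <;>
      simp [caterpillar, caterpillarRel, caterpillarBelow, Fin.ext_iff, -Fin.val_eq_zero_iff]
        at hu hw huw ⊢ <;> omega
  · rcases y with y | l | j <;> simp only [caterpillarRel] at h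
    rcases u with u | l | i <;> rcases w with w | l' | i' <;>
      simp [caterpillar, caterpillarRel, caterpillarBelow, Fin.ext_iff, -Fin.val_eq_zero_iff]
        at hu hw huw ⊢ <;> omega

lemma side_caterpillar {x y : CaterpillarVertex m} (h : caterpillarRel x y) :
    ¬ caterpillarBelow x y ∧ side (caterpillar m) x y = {w | caterpillarBelow x w} := by
  have hy : ¬ caterpillarBelow x y := by
    rcases x with v | k | i <;> rcases y with w | l | j <;>
      simp only [caterpillarRel, caterpillarBelow, not_false_eq_true] at h ⊢ <;> omega
  refine ⟨hy, side_eq_of_unique_crossing caterpillar_connected ?_ hy fun u hu w hw huw =>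
    caterpillarBelow_unique h hu hw huw⟩
  rcases x with v | k | i <;> simp [caterpillarBelow]

lemma caterpillar_isCubicTree : IsCubicTree (caterpillar m) := by
  refine ⟨⟨caterpillar_connected, SimpleGraph.isAcyclic_iff_forall_adj_isBridge.2 ?_⟩, ?_⟩
  · have key : ∀ x y : CaterpillarVertex m, caterpillarRel x y →
        (caterpillar m).IsBridge s(x, y) := fun x y h hreach =>
      (side_caterpillar h).1 ((side_caterpillar h).2.le hreach)
    rintro x y (h | h)
    · exact key x y h
    · rw [Sym2.eq_swap]
      exact key y x h
  · rintro (v | k | i) hw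
    · exact absurd (ncard_neighborSet_leaf v) hw
    · exact ncard_neighborSet_pair k
    · exact ncard_neighborSet_spine i

/-- The decomposition of the vertex set of the ladder given by the caterpillar of pairs. -/
noncomputable def ladderDecomposition (m : ℕ) : PMDecomposition (Fin (m + 2) ⊕ Fin (m + 2)) where
  W := CaterpillarVertex m
  finite := inferInstance
  T := caterpillar m
  cubic := caterpillar_isCubicTree
  δ := (Equiv.ofBijective (fun v => ⟨leaf v, (mem_leaves_caterpillar _).2 ⟨v, rfl⟩⟩)
    ⟨fun u v h => by simpa using h, fun w => by
      obtain ⟨v, hv⟩ := (mem_leaves_caterpillar _).1 w.2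
      exact ⟨v, Subtype.ext hv.symm⟩⟩).symm

lemma mem_shore_ladderDecomposition {x y : CaterpillarVertex m} (h : caterpillarRel x y)
    (v : Fin (m + 2) ⊕ Fin (m + 2)) :
    v ∈ (ladderDecomposition m).shore x y ↔ caterpillarBelow x (leaf v) :=
  Set.ext_iff.1 (side_caterpillar h).2 (leaf v)

lemma porosity_compl_le {V : Type*} [Finite V] {G : SimpleGraph V} {X : Set V} {k : ℕ}
    (h : porosity G X ≤ k) : porosity G Xᶜ ≤ k := by
  rw [porosity_le_iff] at h ⊢
  intro f hf
  have : crossing f Xᶜ ⊆ f '' crossing f X := by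
    rintro v ⟨hv, hv'⟩
    exact ⟨f v, ⟨not_not.1 hv', by rwa [hf.invol]⟩, hf.invol v⟩
  exact ((Set.ncard_le_ncard this).trans (Set.ncard_image_le)).trans (h f hf)

lemma ladder_isBipartiteWith (n : ℕ) :
    (ladder n).IsBipartiteWith (Set.range Sum.inl) (Set.range Sum.inr) where
  disjoint := Set.isCompl_range_inl_range_inr.disjoint
  mem_of_adj := by
    rintro (i | i) (j | j) h
    · exact h.elim
    · simp
    · simp
    · exact h.elim

/-- The cut of the ladder between the first pairs and the others has porosity at most two: no edge
leaves the initial part from the first colour class, and the second has just two more vertices in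
it. -/
lemma porosity_ladder_initial (i : ℕ) (hi : i ≤ m) :
    porosity (ladder (m + 2)) {v | pairIndex v ≤ i} ≤ 2 := by
  rw [porosity_le_iff]
  intro f hf
  have hcover : Set.range Sum.inl ∪ Set.range Sum.inr =
    (Set.univ : Set (Fin (m + 2) ⊕ Fin (m + 2))) := Set.range_inl_union_range_inr
  set X : Set (Fin (m + 2) ⊕ Fin (m + 2)) := {v | pairIndex v ≤ i} with hX
  have h1 := ncard_inter_add_crossing (ladder_isBipartiteWith (m + 2)) hf X
  have h2 := ncard_inter_add_inter (ladder_isBipartiteWith (m + 2)) hcover (crossing f X)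
  have hA : (X ∩ Set.range Sum.inl).ncard = i := by
    have : X ∩ Set.range Sum.inl =
        Set.range fun k : Fin i => Sum.inl (Fin.castLE (show i ≤ m + 2 by omega) k) := by
      ext v
      constructor
      · rintro ⟨hv, a, rfl⟩
        simp only [hX, Set.mem_ofPred_eq, pairIndex] at hv
        exact ⟨⟨a, by omega⟩, rfl⟩
      · rintro ⟨k, rfl⟩
        refine ⟨?_, _, rfl⟩
        simp only [hX, Set.mem_ofPred_eq, pairIndex, Fin.val_castLE]
        omega
    rw [this, Set.ncard_range_of_injective fun k l hkl =>
      Fin.castLE_injective _ (Sum.inl_injective hkl), Nat.card_fin]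
  have hB : (X ∩ Set.range Sum.inr).ncard = i + 2 := by
    have : X ∩ Set.range Sum.inr =
        Set.range fun k : Fin (i + 2) => Sum.inr (Fin.castLE (show i + 2 ≤ m + 2 by omega) k) := by
      ext v
      constructor
      · rintro ⟨hv, a, rfl⟩
        simp only [hX, Set.mem_ofPred_eq, pairIndex] at hv
        exact ⟨⟨a, by omega⟩, rfl⟩
      · rintro ⟨k, rfl⟩
        refine ⟨?_, _, rfl⟩
        simp only [hX, Set.mem_ofPred_eq, pairIndex, Fin.val_castLE]
        omega
    rw [this, Set.ncard_range_of_injective fun k l hkl =>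
      Fin.castLE_injective _ (Sum.inr_injective hkl), Nat.card_fin]
  have h0 : crossing f X ∩ Set.range Sum.inl = ∅ := by
    rw [Set.eq_empty_iff_forall_notMem]
    rintro _ ⟨⟨hv, hv'⟩, a, rfl⟩
    have hadj := hf.adj (Sum.inl a)
    obtain ⟨b, hb⟩ := (ladder_isBipartiteWith (m + 2)).mem_of_mem_adj ⟨a, rfl⟩ hadj
    rw [← hb] at hv' hadj
    have hab : (b : ℕ) ≤ (a : ℕ) + 2 := hadj
    simp only [hX, Set.mem_ofPred_eq, pairIndex] at hv hv'
    omega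
  rw [h0, Set.ncard_empty] at h1 h2
  omega

lemma porosity_le_ncard {V : Type*} [Finite V] {G : SimpleGraph V} (X : Set V) :
    porosity G X ≤ X.ncard :=
  porosity_le_iff.2 fun _ _ => Set.ncard_le_ncard fun _ h => h.1

lemma width_ladderDecomposition_le (m : ℕ) :
    (ladderDecomposition m).width (ladder (m + 2)) ≤ 2 := by
  rw [PMDecomposition.width_le_iff]
  have key : ∀ x y : CaterpillarVertex m, caterpillarRel x y →
      porosity (ladder (m + 2)) ((ladderDecomposition m).shore x y) ≤ 2 := by
    intro x y h
    have hmem := mem_shore_ladderDecomposition h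
    rcases x with v | k | i
    · refine (porosity_le_ncard _).trans ?_
      have : (ladderDecomposition m).shore (leaf v) y = {v} := by
        ext w
        rw [hmem]
        simp [caterpillarBelow]
      rw [this, Set.ncard_singleton]
      exact one_le_two
    · refine (porosity_le_ncard _).trans ?_
      have : (ladderDecomposition m).shore (pair k) y ⊆
          {Sum.inl ⟨k, by omega⟩, Sum.inr ⟨k + 2, by omega⟩} := by
        intro w hw
        rw [hmem] at hw
        rcases w with a | b <;> simp [caterpillarBelow, pairIndex, Fin.ext_iff, -Fin.val_eq_zero_iff] at hw ⊢ <;> omega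
      exact (Set.ncard_le_ncard this).trans (Set.ncard_insert_le _ _ |>.trans (by simp))
    · have : (ladderDecomposition m).shore (spine i) y = {v | pairIndex v ≤ i} := Set.ext hmem
      rw [this]
      refine porosity_ladder_initial _ ?_
      rcases y with w | l | j <;> simp [caterpillarRel] at h
      omega
  rintro _ ⟨x, y, h | h, rfl⟩
  · exact key x y h
  · have := side_compl (caterpillar_isCubicTree (m := m)).1
      (show (caterpillar m).Adj y x from Or.inl h)
    have hs : (ladderDecomposition m).shore x y = ((ladderDecomposition m).shore y x)ᶜ := by
      ext v
      exact Set.ext_iff.1 this (leaf v)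
    rw [hs]
    exact porosity_compl_le (key y x h)

/-! ### Decompositions of spanning subgraphs -/

/-- The decomposition obtained by relabelling the leaves along a bijection. -/
def PMDecomposition.comap {V V' : Type*} (φ : V ≃ V') (D : PMDecomposition V') :
    PMDecomposition V where
  W := D.W
  finite := D.finite
  T := D.T
  cubic := D.cubic
  δ := D.δ.trans φ.symm

lemma PMDecomposition.width_comap_le {V V' : Type*} [Finite V] {G : SimpleGraph V}
    {H : SimpleGraph V'} (φ : V ≃ V') (hφ : ∀ u v, G.Adj u v → H.Adj (φ u) (φ v))
    (D : PMDecomposition V') {k : ℕ} (hk : D.width H ≤ k) : (D.comap φ).width G ≤ k := by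
  have : Finite V' := Finite.of_equiv V φ
  rw [width_le_iff] at hk ⊢
  rintro _ ⟨t₁, t₂, h, rfl⟩
  have h1 := hk _ ⟨t₁, t₂, h, rfl⟩
  rw [porosity_le_iff] at h1 ⊢
  intro f hf
  have h2 := h1 (φ ∘ f ∘ φ.symm) ⟨fun v => by simpa using hφ _ _ (hf.adj (φ.symm v)),
    fun v => by simp [hf.invol]⟩
  rw [← Set.ncard_image_of_injective _ φ.injective]
  refine (Set.ncard_le_ncard ?_).trans h2
  rintro _ ⟨v, ⟨hv, hv'⟩, rfl⟩
  refine ⟨hv, ?_⟩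
  rw [Function.comp_apply, Function.comp_apply, φ.symm_apply_apply]
  exact hv'

lemma exists_decomposition_of_isContained {V : Type*} [Finite V] {G : SimpleGraph V} {n : ℕ}
    (hn : 2 ≤ n) (hV : Nat.card V = 2 * n) (h : G.IsContained (ladder n)) :
    ∃ D : PMDecomposition V, D.width G ≤ 2 := by
  obtain ⟨m, rfl⟩ := Nat.exists_eq_add_of_le' hn
  obtain ⟨c⟩ := h
  have hbij : Function.Bijective c.toHom := by
    refine c.injective'.bijective_of_nat_card_le ?_
    simp [hV, two_mul]
  exact ⟨(ladderDecomposition m).comap (Equiv.ofBijective _ hbij),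
    PMDecomposition.width_comap_le _ (fun u v huv => c.toHom.map_adj huv) _
      (width_ladderDecomposition_le m)⟩

end

end PMWidth

theorem mainTheorem2 {V : Type*} [Finite V] (G : SimpleGraph V) (A B : Set V)
    (hAB : G.IsBipartiteWith A B) (hcover : A ∪ B = Set.univ) (hG : PMWidth.IsBrace G)
    (n : ℕ) (hA : A.ncard = n) (hn : 2 ≤ n) :
    PMWidth.pmw G = 2 ↔ G.IsContained (PMWidth.ladder n) := by
  subst hA
  obtain ⟨a, ha, a', ha', hne⟩ := (Set.one_lt_ncard).1 hn
  have : Nontrivial V := ⟨a, a', hne⟩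
  obtain ⟨b, hab⟩ := hG.2.1.1.preconnected.exists_adj_of_nontrivial a
  obtain ⟨f, hf, -⟩ := hG.exists_isPartner_apply hab
  have hcard := PMWidth.ncard_right_eq_left hAB hf
  have hV : Nat.card V = 2 * A.ncard := by
    have := PMWidth.ncard_inter_add_inter hAB hcover Set.univ
    rw [Set.univ_inter, Set.univ_inter, Set.ncard_univ] at this
    omega
  constructor
  · intro h
    have hne : {k | ∃ D : PMWidth.PMDecomposition V, k = D.width G}.Nonempty := by
      apply Nat.nonempty_of_pos_sInf
      change 0 < PMWidth.pmw G
      omega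
    obtain ⟨D, hD⟩ := Nat.sInf_mem hne
    change PMWidth.pmw G = _ at hD
    exact PMWidth.isContained_ladder_of_shores hAB hcover hG hf D.isShoreFamily
      (D.width_le_iff.1 (by omega))
  · intro h
    obtain ⟨D, hD⟩ := PMWidth.exists_decomposition_of_isContained hn hV h
    have hle : PMWidth.pmw G ≤ D.width G := Nat.sInf_le ⟨D, rfl⟩
    refine le_antisymm (hle.trans hD) (le_csInf ⟨D.width G, D, rfl⟩ ?_)
    rintro _ ⟨D', rfl⟩
    obtain ⟨X, hX, h1, h2⟩ := D'.isShoreFamily.exists_inner (by omega)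
    exact (hG.two_le_porosity hAB hcover h1 h2).trans (D'.width_le_iff.1 le_rfl X hX)
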